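/- Let $1\le p<\infty$, and let $X=(X,d,\mu)$ be a metric space with a positive complete Borel measure $\mu$ (that is, the completion of a measure on the Borel $\sigma$-algebra) such that $0<\mu(B)<\infty$ for all balls $B\subset X$. Fix $x_0\in X$ and write $B_r=B(x_0,r)=\{x\in X: d(x,x_0)<r\}$. A curve is a nonconstant compact rectifiable curve in $X$, parameterized by arc length $ds$ on $[0,l_\gamma]$. A Borel function $g:X\to[0,\infty]$ is an upper gradient of $f:X\to[-\infty,\infty]$ if $$|f(\gamma(0))-f(\gamma(l_\gamma))|\le\int_\gamma g\,ds$$ for all curves $\gamma$, where the left-hand side is understood as $\infty$ if one of its terms is infinite. A measurable $g:X\to[0,\infty]$ is a $p$-weak upper gradient of $f$ if this inequality holds for all curves outside a family $\Gamma$ for which there is $0\le\rho\in L^p(X)$ with $\int_\gamma\rho\,ds=\infty$ for every $\gamma\in\Gamma$. The Newtonian space $N^{1,p}(X)$ consists of the measurable, everywhere defined functions $f:X\to[-\infty,\infty]$ with $\int_X|f|^p\,d\mu+\inf_g\int_X g^p\,d\mu<\infty$, the infimum being over all upper gradients $g$ of $f$. Each $u\in N^{1,p}(X)$ has an a.e.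 unique minimal $p$-weak upper gradient $g_u\in L^p(X)$, i.e. $g_u\le g$ a.e. for every $p$-weak upper gradient $g\in L^p(X)$ of $u$. For $\Omega\subset X$ open and $E\subset\Omega$, the variational $p$-capacity is $$\mathrm{cap}_p(E,\Omega)=\inf_u\int_\Omega g_u^p\,d\mu,$$ where the infimum is over all $u\in N^{1,p}(X)$ with $\chi_E\le u\le1$ in $\Omega$ and $u=0$ on $X\setminus\Omega$. **Theorem.** Assume that there are constants $C_{P}>0$, $\lambda\ge1$, $C_A$, $\tau>1$ and $\kappa>1$ such that the following hold. 1. ($1$-Poincaré inequality at $x_0$) For all $r>0$, all integrable functions $f$ on $X$ and all upper gradients $g$ of $f$, $$\frac1{\mu(B_r)}\int_{B_r}|f-f_{B_r}|\,d\mu\le C_{P}\,r\,\frac1{\mu(B_{\lambda r})}\int_{B_{\lambda r}}g\,d\mu,\qquad f_{B_r}=\frac1{\mu(B_r)}\int_{B_r}f\,d\mu.$$ 2. ($1$-annular decay property at $x_0$) For all $0<r<R$, $$\mu(B_R\setminus B_r)\le C_A\Bigl(1-\frac rR\Bigr)\mu(B_R).$$ 3. (Reverse-doubling at $x_0$ with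 dilation $\tau$) For all $0<r\le\operatorname{diam}X/(2\tau)$, $$\mu(B_{\tau r})\ge\kappa\,\mu(B_r).$$ Then there is a constant $C>0$, depending only on $p$, $C_{P}$, $\lambda$, $C_A$, $\tau$ and $\kappa$ (and not on $X$, $\mu$, $x_0$, $r$, $R$), such that $$\frac1C\Bigl(1-\frac rR\Bigr)^{1-p}\frac{\mu(B_R)}{R^p}\le\mathrm{cap}_p(B_r,B_R)\le C\Bigl(1-\frac rR\Bigr)^{1-p}\frac{\mu(B_R)}{R^p}$$ whenever $0<\frac R2\le r<R\le\frac{\operatorname{diam}X}{2\tau}$ (where $\operatorname{diam} X$ may be infinite). -/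

import Mathlib

open MeasureTheory Set Metric
open scoped ENNReal

namespace MetricMeasure

/-- A nonconstant compact rectifiable curve in `X`, parameterized by arc length: only the values of
`toFun` on `[0, length]` matter, and unit speed there makes the curve `1`-Lipschitz with length
`length`. -/
structure Curve (X : Type*) [MetricSpace X] where
  /-- the length of the curve -/
  length : ℝ
  /-- the arc length parameterization -/
  toFun : ℝ → X
  length_pos : 0 < length
  unitSpeed : HasUnitSpeedOn toFun (Icc 0 length)

section

variable {X : Type*} [MetricSpace X]

/-- The integral `∫_γ g ds` of a nonnegative function along a curve. -/
noncomputable def Curve.lineIntegral (γ : Curve X) (g : X → ℝ≥0∞) : ℝ≥0∞ :=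
  ∫⁻ t in Icc 0 γ.length, g (γ.toFun t)

open Classical in
/-- `|a - b|` for extended real numbers, understood as `∞` if `a` or `b` is infinite. -/
noncomputable def absDiff (a b : EReal) : ℝ≥0∞ :=
  if a = ⊤ ∨ a = ⊥ ∨ b = ⊤ ∨ b = ⊥ then ⊤ else ENNReal.ofReal |a.toReal - b.toReal|

/-- The upper gradient inequality for `f` and `g` along the curve `γ`. -/
def UpperGradientOn (f : X → EReal) (g : X → ℝ≥0∞) (γ : Curve X) : Prop :=
  absDiff (f (γ.toFun 0)) (f (γ.toFun γ.length)) ≤ γ.lineIntegral g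

variable [MeasurableSpace X]

/-- The curve family `Γ` has zero `p`-modulus. -/
def ZeroModulus (p : ℝ) (μ : Measure X) (Γ : Set (Curve X)) : Prop :=
  ∃ ρ : X → ℝ≥0∞, Measurable ρ ∧ ∫⁻ x, ρ x ^ p ∂μ < ∞ ∧ ∀ γ ∈ Γ, γ.lineIntegral ρ = ∞

/-- The Borel function `g` is an upper gradient of `f`. -/
def IsUpperGradient (f : X → EReal) (g : X → ℝ≥0∞) : Prop :=
  Measurable g ∧ ∀ γ : Curve X, UpperGradientOn f g γ

/-- The function `g`, measurable with respect to the completion of `μ`, is a `p`-weak upper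
gradient of `f`. -/
def IsWeakUpperGradient (p : ℝ) (μ : Measure X) (f : X → EReal) (g : X → ℝ≥0∞) : Prop :=
  AEMeasurable g μ ∧ ZeroModulus p μ {γ | ¬ UpperGradientOn f g γ}

/-- The Newtonian norm `(∫ |f|^p dμ + inf_g ∫ g^p dμ)^(1/p)`, with the infimum over all upper
gradients `g` of `f`. -/
noncomputable def newtonianNorm (p : ℝ) (μ : Measure X) (f : X → EReal) : ℝ≥0∞ :=
  (∫⁻ x, (f x).abs ^ p ∂μ +
    ⨅ (g : X → ℝ≥0∞) (_ : IsUpperGradient f g), ∫⁻ x, g x ^ p ∂μ) ^ (1 / p)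

/-- Membership of the everywhere defined function `f` in the Newtonian space `N^{1,p}(X)`. -/
def MemNewtonian (p : ℝ) (μ : Measure X) (f : X → EReal) : Prop :=
  AEMeasurable f μ ∧ newtonianNorm p μ f < ∞

/-- `u` is admissible for the variational `p`-capacity of `E` with respect to `Ω`. -/
def IsAdmissible (p : ℝ) (μ : Measure X) (E Ω : Set X) (u : X → EReal) : Prop :=
  MemNewtonian p μ u ∧ (∀ x ∈ Ω, E.indicator 1 x ≤ u x ∧ u x ≤ 1) ∧ ∀ x ∉ Ω, u x = 0

/-- `∫_Ω g_u^p dμ`, where `g_u` is the minimal `p`-weak upper gradient of `u`. Since `g_u` is itself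
a `p`-weak upper gradient in `L^p` and is a.e. below every other one, this is the least value
of `∫_Ω g^p dμ` over all `p`-weak upper gradients `g` of `u` in `L^p`. -/
noncomputable def minimalEnergy (p : ℝ) (μ : Measure X) (Ω : Set X) (u : X → EReal) : ℝ≥0∞ :=
  ⨅ (g : X → ℝ≥0∞) (_ : IsWeakUpperGradient p μ u g) (_ : ∫⁻ x, g x ^ p ∂μ < ∞),
    ∫⁻ x in Ω, g x ^ p ∂μ

/-- The variational `p`-capacity of `E` with respect to `Ω`. -/
noncomputable def variationalCapacity (p : ℝ) (μ : Measure X) (E Ω : Set X) : ℝ≥0∞ :=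
  ⨅ (u : X → EReal) (_ : IsAdmissible p μ E Ω u), minimalEnergy p μ Ω u

/-- `X` supports a `q`-Poincaré inequality at `x` with constants `C` and `lam`. -/
def PoincareAt (q : ℝ) (μ : Measure X) (x : X) (C lam : ℝ) : Prop :=
  0 < C ∧ 1 ≤ lam ∧
    ∀ r : ℝ, 0 < r → ∀ (f : X → EReal) (g : X → ℝ≥0∞),
      AEMeasurable f μ → ∫⁻ y, (f y).abs ∂μ < ∞ → IsUpperGradient f g →
        ⨍⁻ y in ball x r, ENNReal.ofReal |(f y).toReal - ⨍ z in ball x r, (f z).toReal ∂μ| ∂μ ≤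
          ENNReal.ofReal (C * r) * (⨍⁻ y in ball x (lam * r), g y ^ q ∂μ) ^ (1 / q)

/-- `μ` has the `η`-annular decay property at `x` with constant `C`. -/
def AnnularDecayAt (η : ℝ) (μ : Measure X) (x : X) (C : ℝ) : Prop :=
  ∀ r R : ℝ, 0 < r → r < R →
    μ (ball x R \ ball x r) ≤ ENNReal.ofReal (C * (1 - r / R) ^ η) * μ (ball x R)

/-- `μ` is reverse-doubling at `x` with dilation `τ` and constant `κ`. -/
def ReverseDoublingAt (μ : Measure X) (x : X) (τ κ : ℝ) : Prop :=
  1 < τ ∧ 1 < κ ∧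
    ∀ r : ℝ, 0 < r → ENNReal.ofReal r ≤ ediam (univ : Set X) / ENNReal.ofReal (2 * τ) →
      ENNReal.ofReal κ * μ (ball x r) ≤ μ (ball x (τ * r))

end

end MetricMeasure

/-! ### One-dimensional estimates and integrals along curves. -/

namespace MetricMeasure

/-! Upper bound (`capacity_le`): the test function is `1` on `B_r`, `0` off `B_R` and linear in the
distance between. It has upper gradient `1/(R-r)` on the closed annulus, and annular decay bounds
the measure of `B_R \ B_r` by `C_A (1-r/R) μ(B_R)`.

Lower bound (`le_capacity`): an admissible `u` is `1` on `B_r` and `0` on `B_{τR} \ B_R`. Both sets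
have measure at least `a μ(B_R)`, by the doubling that annular decay implies and by reverse
doubling. The mean oscillation of `u` on `B_{τR}` is thus bounded below, and the `1`-Poincaré
inequality bounds `R ∫ g` below by a multiple of `μ(B_R)`. Since `u` is constant on `B_r` and off
`B_R`, only the integral of `g` over `B_R \ B_r` counts. Hölder's inequality there, with annular
decay again, yields the power `(1-r/R)^(1-p)`.

The technical core is `IsWeakUpperGradient.exists_isUpperGradient_off`: the Poincaré inequality
accepts only genuine Borel upper gradients, so a weak one cut off to the annulus has to be
approximated by these. -/

theorem lintegral_Icc_eq_of_Ioo_subset {h : ℝ → ℝ≥0∞} {s t : ℝ} {E : Set ℝ} (hE : Ioo s t ⊆ Eᶜ) :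
    ∫⁻ x in Icc s t, h x = ∫⁻ x in Ioo s t, Eᶜ.indicator h x := by
  rw [← setLIntegral_congr (Ioo_ae_eq_Icc (μ := volume) (a := s) (b := t))]
  refine setLIntegral_congr_fun measurableSet_Ioo fun x hx => ?_
  rw [indicator_of_mem (hE hx)]

/-- If the oscillation of `f` is controlled by the integral of `h`, then the values of `h` on a
level set of `f` are not needed. -/
theorem abs_sub_le_lintegral_indicator_compl {f : ℝ → ℝ} {h : ℝ → ℝ≥0∞} {a b c : ℝ} {E : Set ℝ}
    (hab : a ≤ b) (hf : ContinuousOn f (Icc a b))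
    (H : ∀ s ∈ Icc a b, ∀ t ∈ Icc a b, s ≤ t →
      ENNReal.ofReal |f s - f t| ≤ ∫⁻ x in Icc s t, h x)
    (hE : ∀ t ∈ Icc a b, t ∈ E → f t = c) :
    ENNReal.ofReal |f a - f b| ≤ ∫⁻ x in Icc a b, Eᶜ.indicator h x := by
  have ha : a ∈ Icc a b := left_mem_Icc.2 hab
  have hb : b ∈ Icc a b := right_mem_Icc.2 hab
  -- Let `s` and `t` be the first and last times at which `f = c`. Since `f s = f t`, only the
  -- oscillation on `[a, s]` and `[t, b]` counts, and the interiors of these intervals miss `E`.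
  set K : Set ℝ := Icc a b ∩ f ⁻¹' {c} with hK
  have hKc : IsCompact K :=
    isCompact_Icc.of_isClosed_subset (hf.preimage_isClosed_of_isClosed isClosed_Icc
      isClosed_singleton) inter_subset_left
  rcases K.eq_empty_or_nonempty with h0 | hne
  · refine (H a ha b hb hab).trans ?_
    rw [lintegral_Icc_eq_of_Ioo_subset (E := E)]
    · exact lintegral_mono_set Ioo_subset_Icc_self
    · intro x hx hxE
      have : x ∈ K := ⟨Ioo_subset_Icc_self hx, hE x (Ioo_subset_Icc_self hx) hxE⟩
      simp [h0] at this
  · obtain ⟨s, hs, hsl⟩ := hKc.exists_isLeast hne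
    obtain ⟨t, ht, htl⟩ := hKc.exists_isGreatest hne
    have hst : s ≤ t := hsl ht
    have h1 : Ioo a s ⊆ Eᶜ := by
      intro x hx hxE
      have hx' : x ∈ Icc a b := ⟨hx.1.le, hx.2.le.trans hs.1.2⟩
      exact absurd (hsl ⟨hx', hE x hx' hxE⟩) (not_le.2 hx.2)
    have h2 : Ioo t b ⊆ Eᶜ := by
      intro x hx hxE
      have hx' : x ∈ Icc a b := ⟨ht.1.1.trans hx.1.le, hx.2.le⟩
      exact absurd (htl ⟨hx', hE x hx' hxE⟩) (not_le.2 hx.1)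
    have e : f s = f t := by
      have e1 : f s = c := hs.2
      have e2 : f t = c := ht.2
      rw [e1, e2]
    have hdis : Disjoint (Ioo a s) (Ioo t b) :=
      Set.disjoint_left.2 fun x hx hx' => absurd (hx.2.trans_le hst) (not_lt.2 hx'.1.le)
    calc ENNReal.ofReal |f a - f b|
        ≤ ENNReal.ofReal (|f a - f s| + |f t - f b|) := by
          apply ENNReal.ofReal_le_ofReal
          calc |f a - f b| = |(f a - f s) + (f t - f b)| := by rw [e]; ring_nf
            _ ≤ _ := abs_add_le _ _
      _ = ENNReal.ofReal |f a - f s| + ENNReal.ofReal |f t - f b| :=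
          ENNReal.ofReal_add (abs_nonneg _) (abs_nonneg _)
      _ ≤ (∫⁻ x in Icc a s, h x) + ∫⁻ x in Icc t b, h x :=
          add_le_add (H a ha s hs.1 hs.1.1) (H t ht.1 b hb ht.1.2)
      _ = ∫⁻ x in Ioo a s ∪ Ioo t b, Eᶜ.indicator h x := by
          rw [lintegral_Icc_eq_of_Ioo_subset h1, lintegral_Icc_eq_of_Ioo_subset h2,
            lintegral_union measurableSet_Ioo hdis]
      _ ≤ _ := lintegral_mono_set (union_subset
          (Ioo_subset_Icc_self.trans (Icc_subset_Icc_right hs.1.2))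
          (Ioo_subset_Icc_self.trans (Icc_subset_Icc_left ht.1.1)))

/-- Absolute continuity of the integral. Continuity is what makes the level sets compact, so that
first and last times exist. -/
theorem continuousOn_of_abs_sub_le_lintegral {f : ℝ → ℝ} {h : ℝ → ℝ≥0∞} {a b : ℝ}
    (hfin : ∫⁻ x in Icc a b, h x ≠ ∞)
    (H : ∀ s ∈ Icc a b, ∀ t ∈ Icc a b, s ≤ t →
      ENNReal.ofReal |f s - f t| ≤ ∫⁻ x in Icc s t, h x) :
    ContinuousOn f (Icc a b) := by
  refine Metric.continuousOn_iff.2 fun t ht ε hε => ?_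
  obtain ⟨δ, hδ, hlt⟩ := exists_pos_setLIntegral_lt_of_measure_lt hfin
    (ENNReal.ofReal_pos.2 hε).ne'
  have key : ∀ s ∈ Icc a b, ∀ t ∈ Icc a b, s ≤ t → ENNReal.ofReal (t - s) < δ →
      |f s - f t| < ε := by
    intro s hs t ht hst hd
    have h1 := hlt (Icc s t) (by
      refine (Measure.restrict_apply_le _ _).trans_lt ?_
      rwa [Real.volume_Icc])
    rw [Measure.restrict_restrict measurableSet_Icc,
      inter_eq_left.2 (Icc_subset_Icc hs.1 ht.2)] at h1
    exact (ENNReal.ofReal_lt_ofReal_iff hε).1 ((H s hs t ht hst).trans_lt h1)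
  obtain ⟨η, hη, hηδ⟩ : ∃ η : ℝ, 0 < η ∧ ENNReal.ofReal η ≤ δ := by
    refine ⟨(min δ 1).toReal, ENNReal.toReal_pos (by simp [hδ.ne']) (by simp), ?_⟩
    rw [ENNReal.ofReal_toReal (by simp)]
    exact min_le_left _ _
  refine ⟨η, hη, fun s hs hd => ?_⟩
  rw [Real.dist_eq] at hd ⊢
  have hd' := abs_lt.1 hd
  have small : ∀ z : ℝ, z < η → ENNReal.ofReal z < δ := fun z hz =>
    ((ENNReal.ofReal_lt_ofReal_iff hη).2 hz).trans_le hηδ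
  rcases le_total s t with hst | hst
  · exact key s hs t ht hst (small _ (by linarith))
  · rw [abs_sub_comm]
    exact key t ht s hs hst (small _ (by linarith))

/-- Hölder's inequality against the constant `1`. -/
theorem rpow_lintegral_le {Y : Type*} [MeasurableSpace Y] {μ : Measure Y} {p : ℝ} (hp : 1 ≤ p)
    {g : Y → ℝ≥0∞}
    (hg : AEMeasurable g μ) (A : Set Y) :
    (∫⁻ x in A, g x ∂μ) ^ p ≤ μ A ^ (p - 1) * ∫⁻ x in A, g x ^ p ∂μ := by
  have hp0 : 0 < p := by linarith
  have h := eLpNorm'_le_eLpNorm'_mul_rpow_measure_univ (p := 1) (q := p) one_pos hp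
    (aestronglyMeasurable_iff_aemeasurable.2 (hg.restrict (s := A)))
  simp only [eLpNorm', enorm_eq_self, ENNReal.rpow_one, div_one, Measure.restrict_apply_univ] at h
  refine (ENNReal.rpow_le_rpow h hp0.le).trans_eq ?_
  rw [ENNReal.mul_rpow_of_nonneg _ _ hp0.le, ← ENNReal.rpow_mul, ← ENNReal.rpow_mul,
    one_div_mul_cancel hp0.ne', ENNReal.rpow_one, mul_comm, sub_mul, one_div_mul_cancel hp0.ne',
    one_mul]

section

variable {X : Type*} [MetricSpace X]

theorem Curve.lipschitzOnWith (γ : Curve X) : LipschitzOnWith 1 γ.toFun (Icc 0 γ.length) := by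
  have key : ∀ s ∈ Icc 0 γ.length, ∀ t ∈ Icc 0 γ.length, s ≤ t →
      edist (γ.toFun s) (γ.toFun t) ≤ edist s t := by
    intro s hs t ht hst
    have h1 := γ.unitSpeed hs ht
    refine (eVariationOn.edist_le γ.toFun (s := Icc 0 γ.length ∩ Icc s t)
      ⟨hs, left_mem_Icc.2 hst⟩ ⟨ht, right_mem_Icc.2 hst⟩).trans ?_
    rw [h1, edist_comm, edist_dist, Real.dist_eq, abs_of_nonneg (sub_nonneg.2 hst)]
    simp
  intro s hs t ht
  rw [ENNReal.coe_one, one_mul]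
  rcases le_total s t with hst | hst
  · exact key s hs t ht hst
  · rw [edist_comm, edist_comm s]
    exact key t ht s hs hst

/-- The part of the curve `γ` between the parameters `s` and `t`. -/
def Curve.sub (γ : Curve X) (s t : ℝ) (hs : 0 ≤ s) (hst : s < t) (ht : t ≤ γ.length) :
    Curve X where
  length := t - s
  toFun x := γ.toFun (s + x)
  length_pos := sub_pos.2 hst
  unitSpeed := by
    intro x hx y hy
    have hx' : s + x ∈ Icc 0 γ.length := ⟨by linarith [hx.1], by linarith [hx.2]⟩
    have hy' : s + y ∈ Icc 0 γ.length := ⟨by linarith [hy.1], by linarith [hy.2]⟩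
    have h1 := γ.unitSpeed hx' hy'
    have h2 := eVariationOn.comp_eq_of_monotoneOn γ.toFun (t := Icc 0 (t - s) ∩ Icc x y)
      (fun z => s + z) (fun _ _ _ _ h => by simpa using h)
    have h3 : (fun z => s + z) '' (Icc 0 (t - s) ∩ Icc x y) =
        Icc 0 γ.length ∩ Icc (s + x) (s + y) := by
      have e1 : Icc 0 (t - s) ∩ Icc x y = Icc x y :=
        inter_eq_right.2 (Icc_subset_Icc hx.1 hy.2)
      have e2 : Icc 0 γ.length ∩ Icc (s + x) (s + y) = Icc (s + x) (s + y) :=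
        inter_eq_right.2 (Icc_subset_Icc hx'.1 hy'.2)
      rw [e1, e2, Set.image_const_add_Icc]
    have h4 : (fun x => γ.toFun (s + x)) = γ.toFun ∘ fun z => s + z := rfl
    rw [h4, h2, h3, h1]
    congr 1
    ring

theorem Curve.lineIntegral_sub (γ : Curve X) (s t : ℝ) (hs : 0 ≤ s) (hst : s < t)
    (ht : t ≤ γ.length) (g : X → ℝ≥0∞) :
    (γ.sub s t hs hst ht).lineIntegral g = ∫⁻ x in Icc s t, g (γ.toFun x) := by
  have h1 := (measurePreserving_add_left volume s).setLIntegral_comp_preimage_emb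
    (measurableEmbedding_addLeft s) (fun x => g (γ.toFun x)) (Icc s t)
  rw [← h1, Set.preimage_const_add_Icc, sub_self]
  rfl

theorem absDiff_coe (a b : ℝ) : absDiff (a : EReal) (b : EReal) = ENNReal.ofReal |a - b| := by
  simp [absDiff]

/-- If `g` satisfies the upper gradient inequality for `f` on all parts of `γ`, and `f` is constant
on `E` and on `F`, then `g` may be replaced by zero on `E ∪ F`. -/
theorem upperGradientOn_indicator {f : X → ℝ} {g : X → ℝ≥0∞} {γ : Curve X} {E F : Set X}
    {c d : ℝ} (hE : ∀ x ∈ E, f x = c) (hF : ∀ x ∈ F, f x = d) (hfin : γ.lineIntegral g ≠ ∞)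
    (H : ∀ s t hs hst ht, UpperGradientOn (fun x => (f x : EReal)) g (γ.sub s t hs hst ht)) :
    UpperGradientOn (fun x => (f x : EReal)) (Fᶜ.indicator (Eᶜ.indicator g)) γ := by
  have H1 : ∀ s ∈ Icc 0 γ.length, ∀ t ∈ Icc 0 γ.length, s ≤ t →
      ENNReal.ofReal |f (γ.toFun s) - f (γ.toFun t)| ≤ ∫⁻ x in Icc s t, g (γ.toFun x) := by
    intro s hs t ht hst
    rcases hst.eq_or_lt with rfl | hlt
    · simp
    have h := H s t hs.1 hlt ht.2
    rw [UpperGradientOn, Curve.lineIntegral_sub, absDiff_coe] at h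
    simpa [Curve.sub] using h
  have hc : ContinuousOn (fun t => f (γ.toFun t)) (Icc 0 γ.length) :=
    continuousOn_of_abs_sub_le_lintegral hfin H1
  -- Removing `E` on every subinterval reproduces the hypothesis with a smaller integrand, so that
  -- `F` can be removed in the same way.
  have H2 : ∀ s ∈ Icc 0 γ.length, ∀ t ∈ Icc 0 γ.length, s ≤ t →
      ENNReal.ofReal |f (γ.toFun s) - f (γ.toFun t)| ≤
        ∫⁻ x in Icc s t, (γ.toFun ⁻¹' E)ᶜ.indicator (fun x => g (γ.toFun x)) x := by
    intro s hs t ht hst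
    have hsub : Icc s t ⊆ Icc 0 γ.length := Icc_subset_Icc hs.1 ht.2
    exact abs_sub_le_lintegral_indicator_compl (f := fun t => f (γ.toFun t)) hst (hc.mono hsub)
      (fun s' hs' t' ht' => H1 s' (hsub hs') t' (hsub ht')) fun x _ hx => hE _ hx
  have H3 := abs_sub_le_lintegral_indicator_compl (f := fun t => f (γ.toFun t)) γ.length_pos.le
    hc H2 (E := γ.toFun ⁻¹' F) fun x _ hx => hF _ hx
  rw [UpperGradientOn, absDiff_coe]
  exact H3

/-- A function of the distance to a point that varies only for distances in `[r, R]` has an upper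
gradient supported there. -/
theorem upperGradientOn_clamp (x₀ : X) {r R : ℝ} (hrR : r ≤ R) (γ : Curve X) :
    ENNReal.ofReal |max r (min R (dist (γ.toFun 0) x₀)) -
        max r (min R (dist (γ.toFun γ.length) x₀))| ≤
      γ.lineIntegral ({x | r ≤ dist x x₀ ∧ dist x x₀ ≤ R}.indicator 1) := by
  set φ : ℝ → ℝ := fun t => dist (γ.toFun t) x₀ with hφ
  set v : ℝ → ℝ := fun t => max r (min R (φ t)) with hv
  set S : Set ℝ := Icc 0 γ.length ∩ {t | r ≤ φ t ∧ φ t ≤ R} with hS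
  have hφL : LipschitzOnWith 1 φ (Icc 0 γ.length) := by
    have := (LipschitzWith.dist_left x₀).comp_lipschitzOnWith γ.lipschitzOnWith
    rwa [one_mul] at this
  have hφc := hφL.continuousOn
  have hvc : ContinuousOn v (Icc 0 γ.length) := by
    exact continuousOn_const.sup (continuousOn_const.inf hφc)
  have hSm : MeasurableSet S := by
    have : S = Icc 0 γ.length ∩ φ ⁻¹' (Icc r R) := rfl
    rw [this]
    exact (hφc.preimage_isClosed_of_isClosed isClosed_Icc isClosed_Icc).measurableSet
  -- Up to the two clamping values, every value between the endpoint values is attained by `φ` at a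
  -- time in `S`. As `φ` is `1`-Lipschitz, `φ '' S` is no longer than `S`, the time spent in the
  -- annulus.
  have himg : uIcc (v 0) (v γ.length) ⊆ φ '' S ∪ {r, R} := by
    intro y hy
    rw [← uIcc_of_le γ.length_pos.le] at hvc
    obtain ⟨t, ht, rfl⟩ := intermediate_value_uIcc hvc hy
    rw [uIcc_of_le γ.length_pos.le] at ht
    rcases lt_or_ge (φ t) r with h1 | h1
    · right; left
      exact max_eq_left ((min_le_right _ _).trans h1.le)
    rcases lt_or_ge R (φ t) with h2 | h2
    · right; right
      change max r (min R (φ t)) = R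
      rw [min_eq_left h2.le, max_eq_right hrR]
    · left
      refine ⟨t, ⟨ht, h1, h2⟩, ?_⟩
      change φ t = max r (min R (φ t))
      rw [min_eq_right h2, max_eq_right h1]
  have hvol : volume (φ '' S) ≤ volume S := by
    have := (hφL.mono (inter_subset_left : S ⊆ _)).hausdorffMeasure_image_le zero_le_one
    simpa [hausdorffMeasure_real] using this
  calc ENNReal.ofReal |v 0 - v γ.length| = volume (uIcc (v 0) (v γ.length)) := by
        rw [uIcc, Real.volume_Icc, max_sub_min_eq_abs, abs_sub_comm]
    _ ≤ volume (φ '' S ∪ {r, R}) := measure_mono himg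
    _ ≤ volume (φ '' S) + volume ({r, R} : Set ℝ) := measure_union_le _ _
    _ = volume (φ '' S) := by
        rw [(Set.toFinite ({r, R} : Set ℝ)).measure_zero, add_zero]
    _ ≤ volume S := hvol
    _ = ∫⁻ t in Icc 0 γ.length, S.indicator 1 t := by
        rw [lintegral_indicator_one hSm, Measure.restrict_apply hSm,
          inter_eq_left.2 inter_subset_left]
    _ = _ := by
        refine setLIntegral_congr_fun measurableSet_Icc fun t ht => ?_
        simp only [indicator, hS, mem_inter_iff, ht, true_and, mem_ofPred_eq, hφ, Pi.one_apply]

end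

end MetricMeasure

/-! ### Weak upper gradients, and doubling from annular decay. -/

namespace MetricMeasure

section

variable {X : Type*} [MetricSpace X] [MeasurableSpace X]

theorem IsUpperGradient.isWeakUpperGradient {p : ℝ} (hp : 0 < p) {μ : Measure X} {f : X → EReal}
    {g : X → ℝ≥0∞} (hg : IsUpperGradient f g) : IsWeakUpperGradient p μ f g :=
  ⟨hg.1.aemeasurable, 0, measurable_const, by simp [ENNReal.zero_rpow_of_pos hp],
    fun γ hγ => absurd (hg.2 γ) hγ⟩

/-- A weak upper gradient lies below a Borel function `g'`, equal to it almost everywhere, such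
that adding a suitable `p`-integrable function `ρ` leaves only curves along which `g' + ρ` is not
integrable as exceptions, also for the parts of the curve. -/
theorem IsWeakUpperGradient.exists_measurable {p : ℝ} {μ : Measure X} {f : X → EReal}
    {g : X → ℝ≥0∞} (hg : IsWeakUpperGradient p μ f g) :
    ∃ g' ρ : X → ℝ≥0∞, Measurable g' ∧ g' =ᵐ[μ] g ∧ Measurable ρ ∧ ∫⁻ x, ρ x ^ p ∂μ < ∞ ∧
      ∀ γ : Curve X, γ.lineIntegral (g' + ρ) ≠ ∞ →
        ∀ s t hs hst ht, UpperGradientOn f g' (γ.sub s t hs hst ht) := by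
  obtain ⟨hgm, ρ, hρ, hρp, hρΓ⟩ := hg
  obtain ⟨N, hN, hNm, hN0⟩ := exists_measurable_superset_of_null
    (show μ {x | g x ≠ hgm.mk g x} = 0 from hgm.ae_eq_mk)
  classical
  -- The value `∞` on the null set `N` gives `g ≤ g'` everywhere, so the inequality passes from `g`
  -- to `g'` along every curve, including those that run inside `N`.
  refine ⟨N.piecewise (fun _ => ∞) (hgm.mk g), ρ,
    Measurable.piecewise hNm measurable_const hgm.measurable_mk, ?_, hρ, hρp, ?_⟩
  · have : ∀ᵐ x ∂μ, x ∉ N := measure_eq_zero_iff_ae_notMem.1 hN0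
    filter_upwards [this, hgm.ae_eq_mk] with x hx hx'
    rw [piecewise_eq_of_notMem _ _ _ hx, hx']
  · intro γ hγ s t hs hst ht
    by_contra hcon
    have hle : ∀ x, g x ≤ N.piecewise (fun _ => ∞) (hgm.mk g) x := by
      intro x
      by_cases hx : x ∈ N
      · simp [hx]
      · rw [piecewise_eq_of_notMem _ _ _ hx]
        by_contra h
        exact hx (hN fun h' => h h'.le)
    have h1 : ¬ UpperGradientOn f g (γ.sub s t hs hst ht) := fun h =>
      hcon (h.trans (lintegral_mono fun x => hle _))
    have h2 := hρΓ _ h1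
    rw [Curve.lineIntegral_sub] at h2
    refine hγ (top_le_iff.1 ?_)
    rw [← h2]
    calc ∫⁻ x in Icc s t, ρ (γ.toFun x) ≤ γ.lineIntegral ρ :=
          lintegral_mono_set (Icc_subset_Icc hs ht)
      _ ≤ _ := lintegral_mono fun x => le_add_self

/-- If `f` is constant on the sets `E` and `F`, then a weak upper gradient can be removed there,
up to an arbitrarily small error. -/
theorem IsWeakUpperGradient.exists_isUpperGradient_off {p : ℝ} (hp : 1 ≤ p)
    {μ : Measure X} {f : X → ℝ} {g : X → ℝ≥0∞} (hg : IsWeakUpperGradient p μ (fun x => f x) g)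
    (hgp : ∫⁻ x, g x ^ p ∂μ < ∞) {E F B : Set X} {c d : ℝ} (hEm : MeasurableSet E)
    (hFm : MeasurableSet F) (hE : ∀ x ∈ E, f x = c) (hF : ∀ x ∈ F, f x = d) (hB : μ B < ∞)
    {ε : ℝ≥0∞} (hε : ε ≠ 0) :
    ∃ h : X → ℝ≥0∞, IsUpperGradient (fun x => (f x : EReal)) h ∧
      ∫⁻ x in B, h x ∂μ ≤ ∫⁻ x in (E ∪ F)ᶜ, g x ∂μ + ε := by
  obtain ⟨g', ρ, hg'm, hg'g, hρm, hρp, H⟩ := hg.exists_measurable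
  have hbound : ∀ w : X → ℝ≥0∞, ∫⁻ x, w x ^ p ∂μ < ∞ → ∫⁻ x in B, w x ∂μ < ∞ := by
    intro w hw
    calc ∫⁻ x in B, w x ∂μ ≤ ∫⁻ x in B, (1 + w x ^ p) ∂μ := by
          refine lintegral_mono fun x => ?_
          rcases le_total (w x) 1 with h1 | h1
          · exact h1.trans le_self_add
          · exact (ENNReal.le_rpow_self_of_one_le h1 hp).trans le_add_self
      _ = μ B + ∫⁻ x in B, w x ^ p ∂μ := by
          rw [lintegral_add_left measurable_const]; simp
      _ ≤ μ B + ∫⁻ x, w x ^ p ∂μ := by gcongr; exact Measure.restrict_le_self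
      _ < ∞ := ENNReal.add_lt_top.2 ⟨hB, hw⟩
  set M : ℝ≥0∞ := ∫⁻ x in B, (g' x + ρ x) ∂μ with hM
  have hMfin : M ≠ ∞ := by
    rw [hM, lintegral_add_left hg'm]
    refine (ENNReal.add_lt_top.2 ⟨hbound g' ?_, hbound ρ hρp⟩).ne
    rwa [lintegral_congr_ae (hg'g.mono fun x hx => by rw [hx])]
  obtain ⟨δ, hδ0, hδ⟩ : ∃ δ : ℝ≥0∞, δ ≠ 0 ∧ δ * M ≤ ε := by
    rcases eq_or_ne ε ∞ with rfl | hεt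
    · exact ⟨1, one_ne_zero, le_top⟩
    refine ⟨ε / (M + 1), ENNReal.div_ne_zero.2 ⟨hε, by simp [hMfin]⟩, ?_⟩
    calc ε / (M + 1) * M ≤ ε / (M + 1) * (M + 1) := by gcongr; exact le_self_add
      _ = ε := ENNReal.div_mul_cancel (by simp) (by simp [hMfin])
  -- The second term has infinite integral along all exceptional curves however small `δ` is; along
  -- the others the first term suffices.
  refine ⟨fun x => Fᶜ.indicator (Eᶜ.indicator g') x + δ * (g' x + ρ x), ⟨?_, ?_⟩, ?_⟩
  · exact ((hg'm.indicator hEm.compl).indicator hFm.compl).add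
      ((hg'm.add hρm).const_mul δ)
  · intro γ
    by_cases hγ : γ.lineIntegral (g' + ρ) = ∞
    · have h1 : γ.lineIntegral (fun x => δ * (g' x + ρ x)) = ∞ := by
        refine top_le_iff.1 ?_
        calc ∞ = δ * γ.lineIntegral (g' + ρ) := by rw [hγ, ENNReal.mul_top hδ0]
          _ ≤ _ := lintegral_const_mul_le _ _
      refine le_top.trans ?_
      rw [← h1]
      exact lintegral_mono fun x => le_add_self
    · have hγ' : γ.lineIntegral g' ≠ ∞ := fun h => hγ (top_le_iff.1 (by
        rw [← h]; exact lintegral_mono fun x => le_self_add))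
      exact (upperGradientOn_indicator hE hF hγ' (H γ hγ)).trans
        (lintegral_mono fun x => le_self_add)
  · rw [lintegral_add_left ((hg'm.indicator hEm.compl).indicator hFm.compl),
      show ∫⁻ x in B, δ * (g' x + ρ x) ∂μ = δ * M from lintegral_const_mul _ (hg'm.add hρm)]
    refine add_le_add ?_ hδ
    calc ∫⁻ x in B, Fᶜ.indicator (Eᶜ.indicator g') x ∂μ
        ≤ ∫⁻ x, Fᶜ.indicator (Eᶜ.indicator g') x ∂μ :=
          lintegral_mono' Measure.restrict_le_self le_rfl
      _ = ∫⁻ x in (E ∪ F)ᶜ, g' x ∂μ := by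
          rw [indicator_indicator, ← compl_union, union_comm,
            lintegral_indicator (hEm.union hFm).compl]
      _ = _ := lintegral_congr_ae (ae_restrict_of_ae hg'g)

/-- Annular decay at a point implies doubling there. -/
theorem AnnularDecayAt.measure_ball_le [BorelSpace X] {μ : Measure X} {x₀ : X} {CA K : ℝ} {n : ℕ}
    (hCA : AnnularDecayAt 1 μ x₀ CA) (hμ : ∀ r : ℝ, 0 < r → μ (ball x₀ r) < ∞)
    (hK : 1 ≤ K) (hCK : CA ≤ K) (hn : (1 - 1 / (2 * K)) ^ n ≤ 1 / 2) {r R : ℝ} (hR : 0 < R)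
    (hr : R / 2 ≤ r) :
    μ (ball x₀ R) ≤ 2 ^ n * μ (ball x₀ r) := by
  -- Chosen so that `CA * (1 - q) ≤ 1 / 2`: shrinking the radius by `q` loses at most half of the
  -- measure, and `n` shrinkings take `R` to at most `R / 2`.
  set q : ℝ := 1 - 1 / (2 * K) with hq
  have hK2 : 1 / (2 * K) ≤ 1 / 2 := one_div_le_one_div_of_le (by norm_num) (by linarith)
  have hK0 : 0 < 1 / (2 * K) := by positivity
  have hq0 : 0 < q := by linarith
  have hq1 : q < 1 := by linarith
  have step : ∀ s : ℝ, 0 < s → μ (ball x₀ s) ≤ 2 * μ (ball x₀ (q * s)) := by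
    intro s hs
    have hqs : q * s < s := by nlinarith
    have h1 := hCA (q * s) s (by positivity) hqs
    have h2 : ENNReal.ofReal (CA * (1 - q * s / s) ^ (1 : ℝ)) ≤ 2⁻¹ := by
      rw [mul_div_cancel_right₀ _ hs.ne', Real.rpow_one]
      rw [show (2⁻¹ : ℝ≥0∞) = ENNReal.ofReal (1 / 2) by
        rw [one_div, ENNReal.ofReal_inv_of_pos two_pos]; simp]
      apply ENNReal.ofReal_le_ofReal
      have : 1 - q = 1 / (2 * K) := by rw [hq]; ring
      rw [this]
      calc CA * (1 / (2 * K)) ≤ K * (1 / (2 * K)) := by gcongr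
        _ = 1 / 2 := by field_simp
    have h3 : μ (ball x₀ s) ≤ μ (ball x₀ (q * s)) + 2⁻¹ * μ (ball x₀ s) := by
      calc μ (ball x₀ s) ≤ μ (ball x₀ (q * s)) + μ (ball x₀ s \ ball x₀ (q * s)) := by
            rw [measure_add_sdiff measurableSet_ball.nullMeasurableSet]
            exact measure_mono subset_union_right
        _ ≤ _ := by gcongr; exact h1.trans (by gcongr)
    have hfin := (hμ s hs).ne
    have hfin' := (hμ (q * s) (by positivity)).ne
    lift μ (ball x₀ s) to NNReal using hfin with a
    lift μ (ball x₀ (q * s)) to NNReal using hfin' with b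
    have h4 : a ≤ b + 2⁻¹ * a := by
      rw [← ENNReal.coe_le_coe]
      rw [ENNReal.coe_add, ENNReal.coe_mul, ENNReal.coe_inv two_ne_zero]
      exact h3
    have h5 : (a : ℝ) ≤ b + 2⁻¹ * a := by exact_mod_cast h4
    have h6 : (a : ℝ) ≤ 2 * b := by linarith
    exact_mod_cast h6
  have iter : ∀ k : ℕ, μ (ball x₀ R) ≤ 2 ^ k * μ (ball x₀ (q ^ k * R)) := by
    intro k
    induction k with
    | zero => simp
    | succ k ih =>
      calc μ (ball x₀ R) ≤ 2 ^ k * μ (ball x₀ (q ^ k * R)) := ih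
        _ ≤ 2 ^ k * (2 * μ (ball x₀ (q * (q ^ k * R)))) := by
            gcongr; exact step _ (by positivity)
        _ = _ := by rw [← mul_assoc, ← pow_succ, ← mul_assoc, ← pow_succ']
  refine (iter n).trans ?_
  gcongr
  nlinarith

end

end MetricMeasure

/-! ### The two capacity estimates. -/

namespace MetricMeasure

section

variable {X : Type*} [MetricSpace X] [MeasurableSpace X] [BorelSpace X]

theorem capacity_le {p : ℝ} (hp : 1 ≤ p) {μ : Measure X} {x₀ : X} {K CA r R : ℝ}
    (hμ : ∀ r : ℝ, 0 < r → μ (ball x₀ r) < ∞) (hCA : AnnularDecayAt 1 μ x₀ CA) (hCK : CA ≤ K)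
    (hr : 0 < r) (hrR : r < R) :
    variationalCapacity p μ (ball x₀ r) (ball x₀ R) ≤
      ENNReal.ofReal (K * ((1 - r / R) ^ (1 - p) / R ^ p)) * μ (ball x₀ R) := by
  have hp0 : 0 < p := by linarith
  have hR : 0 < R := hr.trans hrR
  have hd : 0 < R - r := sub_pos.2 hrR
  set f : X → ℝ := fun x => (R - max r (min R (dist x x₀))) / (R - r) with hf
  set A : Set X := {x | r ≤ dist x x₀ ∧ dist x x₀ ≤ R} with hA
  have hAm : MeasurableSet A := by
    have : A = (fun x => dist x x₀) ⁻¹' Icc r R := rfl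
    rw [this]
    exact (isClosed_Icc.preimage (continuous_id.dist continuous_const)).measurableSet
  set L : ℝ≥0∞ := ENNReal.ofReal (1 / (R - r)) with hL
  set g : X → ℝ≥0∞ := fun x => L * A.indicator 1 x with hg
  have hfcont : Continuous f := by fun_prop
  have hf0 : ∀ x, 0 ≤ f x := fun x =>
    div_nonneg (sub_nonneg.2 (max_le hrR.le (min_le_left _ _))) hd.le
  have hf1 : ∀ x, f x ≤ 1 := fun x =>
    (div_le_one hd).2 (sub_le_sub_left (le_max_left _ _) _)
  have hfin : ∀ x ∈ ball x₀ r, f x = 1 := by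
    intro x hx
    have hx' : dist x x₀ < r := hx
    simp only [hf]
    rw [min_eq_right (hx'.trans hrR).le, max_eq_left hx'.le, div_self hd.ne']
  have hfout : ∀ x ∉ ball x₀ R, f x = 0 := by
    intro x hx
    have hx' : R ≤ dist x x₀ := not_lt.1 hx
    simp only [hf]
    rw [min_eq_left hx', max_eq_right hrR.le, sub_self, zero_div]
  have hgug : IsUpperGradient (fun x => (f x : EReal)) g := by
    refine ⟨(measurable_one.indicator hAm).const_mul L, fun γ => ?_⟩
    rw [UpperGradientOn, absDiff_coe]
    have h1 := upperGradientOn_clamp x₀ hrR.le γ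
    calc ENNReal.ofReal |f (γ.toFun 0) - f (γ.toFun γ.length)|
        = L * ENNReal.ofReal |max r (min R (dist (γ.toFun 0) x₀)) -
            max r (min R (dist (γ.toFun γ.length) x₀))| := by
          rw [hL, ← ENNReal.ofReal_mul (by positivity), abs_sub_comm (max r _)]
          congr 1
          rw [← abs_of_nonneg (show 0 ≤ 1 / (R - r) by positivity), ← abs_mul]
          congr 1
          simp only [hf]
          ring
      _ ≤ L * γ.lineIntegral (A.indicator 1) := by gcongr
      _ ≤ _ := lintegral_const_mul_le _ _
  have hgpow : ∀ x, g x ^ p = L ^ p * A.indicator 1 x := by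
    intro x
    by_cases hx : x ∈ A
    · simp [hg, hx]
    · simp [hg, hx, hp0]
  have hgint : ∀ S : Set X, ∫⁻ x in S, g x ^ p ∂μ = L ^ p * μ (A ∩ S) := by
    intro S
    simp only [hgpow]
    rw [lintegral_const_mul _ (measurable_one.indicator hAm), lintegral_indicator_one hAm,
      Measure.restrict_apply hAm]
  have hLp : L ^ p ≠ ∞ := ENNReal.rpow_ne_top_of_nonneg hp0.le ENNReal.ofReal_ne_top
  have hgfin : ∫⁻ x, g x ^ p ∂μ < ∞ := by
    rw [← Measure.restrict_univ (μ := μ), hgint, inter_univ]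
    refine ENNReal.mul_lt_top hLp.lt_top
      ((measure_mono fun x hx => ?_).trans_lt (hμ (R + 1) (by linarith)))
    exact lt_of_le_of_lt hx.2 (by linarith)
  have hadm : IsAdmissible p μ (ball x₀ r) (ball x₀ R) (fun x => (f x : EReal)) := by
    refine ⟨⟨(measurable_coe_real_ereal.comp hfcont.measurable).aemeasurable, ?_⟩, ?_, ?_⟩
    · refine ENNReal.rpow_lt_top_of_nonneg (by positivity) (ENNReal.add_lt_top.2 ⟨?_, ?_⟩).ne
      · calc ∫⁻ x, (f x : EReal).abs ^ p ∂μ ≤ ∫⁻ x, (ball x₀ R).indicator 1 x ∂μ := by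
              refine lintegral_mono fun x => ?_
              rw [EReal.abs_def, abs_of_nonneg (hf0 x)]
              by_cases hx : x ∈ ball x₀ R
              · rw [indicator_of_mem hx]
                refine (ENNReal.rpow_le_rpow (ENNReal.ofReal_le_ofReal (hf1 x)) hp0.le).trans ?_
                simp
              · rw [hfout x hx]
                simp [hp0]
          _ = μ (ball x₀ R) := lintegral_indicator_one measurableSet_ball
          _ < ∞ := hμ R hR
      · exact (iInf₂_le g hgug).trans_lt hgfin
    · intro x _
      refine ⟨?_, EReal.coe_le_coe_iff.2 (hf1 x)⟩
      by_cases hx : x ∈ ball x₀ r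
      · simp [indicator_of_mem hx, hfin x hx]
      · rw [indicator_of_notMem hx]
        exact EReal.coe_nonneg.2 (hf0 x)
    · intro x hx
      simp [hfout x hx]
  calc variationalCapacity p μ (ball x₀ r) (ball x₀ R)
      ≤ minimalEnergy p μ (ball x₀ R) (fun x => (f x : EReal)) := iInf₂_le _ hadm
    _ ≤ ∫⁻ x in ball x₀ R, g x ^ p ∂μ :=
        iInf_le_of_le g (iInf₂_le (hgug.isWeakUpperGradient hp0) hgfin)
    _ = L ^ p * μ (A ∩ ball x₀ R) := hgint _
    -- The sphere `dist x x₀ = R` in `A` drops out because the energy is taken over the open ball.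
    _ ≤ L ^ p * μ (ball x₀ R \ ball x₀ r) := by
        gcongr
        exact fun x hx => ⟨hx.2, not_lt.2 hx.1.1⟩
    _ ≤ L ^ p * (ENNReal.ofReal (K * (1 - r / R)) * μ (ball x₀ R)) := by
        gcongr
        refine (hCA r R hr hrR).trans ?_
        have : 0 ≤ 1 - r / R := sub_nonneg.2 ((div_le_one hR).2 hrR.le)
        rw [Real.rpow_one]
        gcongr
    _ = _ := by
        have hδ : 0 < 1 - r / R := sub_pos.2 ((div_lt_one hR).2 hrR)
        rw [← mul_assoc, hL, ENNReal.ofReal_rpow_of_pos (by positivity),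
          ← ENNReal.ofReal_mul (by positivity)]
        congr 2
        have e : R - r = R * (1 - r / R) := by field_simp
        rw [e, one_div, Real.inv_rpow (by positivity), Real.mul_rpow hR.le hδ.le,
          Real.rpow_sub hδ, Real.rpow_one]
        have h1 : 0 < (1 - r / R) ^ p := Real.rpow_pos_of_pos hδ p
        have h2 : 0 < R ^ p := Real.rpow_pos_of_pos hR p
        generalize (1 - r / R) ^ p = a at h1 ⊢
        generalize R ^ p = b at h2 ⊢
        field_simp

/-- The Poincaré inequality on a ball `B_{τR}` bounds upper gradients of functions which are `1` on
`B_r` and `0` outside `B_R` from below. -/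
theorem le_lintegral_of_poincareAt {μ : Measure X} {x₀ : X} {CP lam τ κ r R a : ℝ}
    (hμ : ∀ r : ℝ, 0 < r → 0 < μ (ball x₀ r) ∧ μ (ball x₀ r) < ∞)
    (hP : PoincareAt 1 μ x₀ CP lam) (hτ : 1 < τ) (hκ : 1 < κ) (hR : 0 < R) (hrR : r < R)
    (hrev : ENNReal.ofReal κ * μ (ball x₀ R) ≤ μ (ball x₀ (τ * R)))
    (ha : ENNReal.ofReal a * μ (ball x₀ R) ≤ μ (ball x₀ r)) (haκ : a ≤ κ - 1)
    {f : X → ℝ} {h : X → ℝ≥0∞} (hfm : AEMeasurable (fun x => (f x : EReal)) μ)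
    (hf : ∀ x, 0 ≤ f x ∧ f x ≤ 1) (hf1 : ∀ x ∈ ball x₀ r, f x = 1)
    (hf0 : ∀ x ∉ ball x₀ R, f x = 0) (hh : IsUpperGradient (fun x => (f x : EReal)) h) :
    ENNReal.ofReal a * μ (ball x₀ R) ≤
      ENNReal.ofReal (CP * (τ * R)) * ∫⁻ x in ball x₀ (lam * (τ * R)), h x ∂μ := by
  obtain ⟨hCP, hlam, hP⟩ := hP
  have hρ : 0 < τ * R := by positivity
  have hRρ : R ≤ τ * R := by nlinarith
  have hfint : ∫⁻ x, (f x : EReal).abs ∂μ < ∞ := by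
    calc ∫⁻ x, (f x : EReal).abs ∂μ ≤ ∫⁻ x, (ball x₀ R).indicator 1 x ∂μ := by
          refine lintegral_mono fun x => ?_
          rw [EReal.abs_def, abs_of_nonneg (hf x).1]
          by_cases hx : x ∈ ball x₀ R
          · rw [indicator_of_mem hx]
            simpa using (hf x).2
          · simp [hf0 x hx]
      _ = μ (ball x₀ R) := lintegral_indicator_one measurableSet_ball
      _ < ∞ := (hμ R hR).2
  have h1 := hP (τ * R) hρ (fun x => (f x : EReal)) h hfm hfint hh
  simp only [ENNReal.rpow_one, div_one, EReal.toReal_coe] at h1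
  set c : ℝ := ⨍ z in ball x₀ (τ * R), f z ∂μ with hc
  rw [setLAverage_eq, setLAverage_eq] at h1
  set I := ∫⁻ x in ball x₀ (lam * (τ * R)), h x ∂μ with hI
  have h2 : ∫⁻ y in ball x₀ (τ * R), ENNReal.ofReal |f y - c| ∂μ ≤
      ENNReal.ofReal (CP * (τ * R)) * I := by
    rw [ENNReal.div_le_iff (hμ _ hρ).1.ne' (hμ _ hρ).2.ne] at h1
    refine h1.trans ?_
    rw [mul_assoc]
    gcongr
    -- The larger measure of the dilated ball only helps, so `lam` does not enter the constant.
    refine (mul_le_mul_right (measure_mono (ball_subset_ball ?_)) _).trans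
      ((mul_comm _ _).trans_le ENNReal.mul_div_le)
    nlinarith
  refine le_trans ?_ h2
  set t := ENNReal.ofReal a * μ (ball x₀ R) with ht
  -- Reverse doubling leaves at least `(κ - 1) μ(B_R)` outside `B_R`.
  have hout : t ≤ μ (ball x₀ (τ * R) \ ball x₀ R) := by
    rw [measure_sdiff (ball_subset_ball hRρ) measurableSet_ball.nullMeasurableSet (hμ R hR).2.ne]
    refine ENNReal.le_sub_of_add_le_right (hμ R hR).2.ne (le_trans ?_ hrev)
    calc t + μ (ball x₀ R) ≤ ENNReal.ofReal (κ - 1) * μ (ball x₀ R) + 1 * μ (ball x₀ R) := by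
          rw [one_mul, ht]; gcongr
      _ = ENNReal.ofReal κ * μ (ball x₀ R) := by
          rw [← add_mul, ← ENNReal.ofReal_one, ← ENNReal.ofReal_add (by linarith) zero_le_one,
            sub_add_cancel]
  have hdis : Disjoint (ball x₀ r) (ball x₀ (τ * R) \ ball x₀ R) :=
    Set.disjoint_left.2 fun x hx hx' => hx'.2 (ball_subset_ball hrR.le hx)
  have hm : MeasurableSet (ball x₀ (τ * R) \ ball x₀ R) := measurableSet_ball.diff measurableSet_ball
  -- Whatever the mean `c` is, its distances to the values `1` and `0` add up to at least `1`.
  calc t ≤ (ENNReal.ofReal |1 - c| + ENNReal.ofReal |0 - c|) * t := by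
        rw [← ENNReal.ofReal_add (abs_nonneg _) (abs_nonneg _)]
        refine le_mul_of_one_le_left' (ENNReal.one_le_ofReal.2 ?_)
        calc (1 : ℝ) = |(1 - c) - (0 - c)| := by simp
          _ ≤ _ := abs_sub _ _
    _ ≤ ENNReal.ofReal |1 - c| * μ (ball x₀ r) +
          ENNReal.ofReal |0 - c| * μ (ball x₀ (τ * R) \ ball x₀ R) := by
        rw [add_mul]; gcongr
    _ = ∫⁻ y in ball x₀ r ∪ (ball x₀ (τ * R) \ ball x₀ R), ENNReal.ofReal |f y - c| ∂μ := by
        rw [lintegral_union hm hdis, ← setLIntegral_const, ← setLIntegral_const]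
        congr 1
        · exact setLIntegral_congr_fun measurableSet_ball fun x hx => by simp only [hf1 x hx]
        · exact setLIntegral_congr_fun hm fun x hx => by simp only [hf0 x hx.2]
    _ ≤ _ := lintegral_mono_set (union_subset (ball_subset_ball (hrR.le.trans hRρ)) sdiff_subset)

/-- The previous estimate is applied to genuine upper gradients whose integral over the dilated ball
exceeds that of `g` over the annulus by at most `ε`. -/
theorem le_lintegral_annulus {p : ℝ} (hp : 1 ≤ p) {μ : Measure X} {x₀ : X}
    {CP lam τ κ r R a : ℝ}
    (hμ : ∀ r : ℝ, 0 < r → 0 < μ (ball x₀ r) ∧ μ (ball x₀ r) < ∞)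
    (hP : PoincareAt 1 μ x₀ CP lam) (hτ : 1 < τ) (hκ : 1 < κ) (hR : 0 < R) (hrR : r < R)
    (hrev : ENNReal.ofReal κ * μ (ball x₀ R) ≤ μ (ball x₀ (τ * R)))
    (ha : ENNReal.ofReal a * μ (ball x₀ R) ≤ μ (ball x₀ r)) (haκ : a ≤ κ - 1)
    {f : X → ℝ} {g : X → ℝ≥0∞} (hfm : AEMeasurable (fun x => (f x : EReal)) μ)
    (hf : ∀ x, 0 ≤ f x ∧ f x ≤ 1) (hf1 : ∀ x ∈ ball x₀ r, f x = 1)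
    (hf0 : ∀ x ∉ ball x₀ R, f x = 0) (hg : IsWeakUpperGradient p μ (fun x => (f x : EReal)) g)
    (hgp : ∫⁻ x, g x ^ p ∂μ < ∞) :
    ENNReal.ofReal a * μ (ball x₀ R) ≤
      ENNReal.ofReal (CP * (τ * R)) * ∫⁻ x in ball x₀ R \ ball x₀ r, g x ∂μ := by
  have hCP := hP.1
  have hlam := hP.2.1
  have hK0 : ENNReal.ofReal (CP * (τ * R)) ≠ 0 := (ENNReal.ofReal_pos.2 (by positivity)).ne'
  rw [mul_comm (ENNReal.ofReal (CP * _)),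
    ← ENNReal.div_le_iff hK0 ENNReal.ofReal_ne_top]
  refine ENNReal.le_of_forall_pos_le_add fun ε hε _ => ?_
  obtain ⟨h, hh, hint⟩ := hg.exists_isUpperGradient_off hp hgp
    (E := ball x₀ r) (F := (ball x₀ R)ᶜ) (B := ball x₀ (lam * (τ * R))) (c := 1) (d := 0)
    measurableSet_ball measurableSet_ball.compl hf1 hf0
    (hμ _ (by positivity)).2 (ε := ε) (by exact_mod_cast hε.ne')
  have e : (ball x₀ r ∪ (ball x₀ R)ᶜ)ᶜ = ball x₀ R \ ball x₀ r := by
    rw [compl_union, compl_compl, inter_comm]; rfl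
  rw [e] at hint
  refine le_trans ?_ hint
  rw [ENNReal.div_le_iff hK0 ENNReal.ofReal_ne_top, mul_comm _ (ENNReal.ofReal (CP * _))]
  exact le_lintegral_of_poincareAt hμ hP hτ hκ hR hrR hrev ha haκ hfm hf hf1 hf0 hh

theorem le_capacity {p : ℝ} (hp : 1 ≤ p) {μ : Measure X} {x₀ : X}
    {CP lam CA K τ κ r R a : ℝ}
    (hμ : ∀ r : ℝ, 0 < r → 0 < μ (ball x₀ r) ∧ μ (ball x₀ r) < ∞)
    (hP : PoincareAt 1 μ x₀ CP lam) (hCA : AnnularDecayAt 1 μ x₀ CA) (hCK : CA ≤ K) (hK : 0 < K)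
    (hτ : 1 < τ) (hκ : 1 < κ) (hr : 0 < r) (hrR : r < R)
    (hrev : ENNReal.ofReal κ * μ (ball x₀ R) ≤ μ (ball x₀ (τ * R))) (ha0 : 0 < a)
    (ha : ENNReal.ofReal a * μ (ball x₀ R) ≤ μ (ball x₀ r)) (haκ : a ≤ κ - 1) :
    ENNReal.ofReal ((a / (CP * τ)) ^ p * K ^ (1 - p) * ((1 - r / R) ^ (1 - p) / R ^ p)) *
      μ (ball x₀ R) ≤ variationalCapacity p μ (ball x₀ r) (ball x₀ R) := by
  have hR : 0 < R := hr.trans hrR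
  have hCP := hP.1
  have hp0 : 0 < p := by linarith
  have hδ : 0 < 1 - r / R := sub_pos.2 ((div_lt_one hR).2 hrR)
  refine le_iInf₂ fun u hu => le_iInf fun g => le_iInf₂ fun hg hgp => ?_
  obtain ⟨⟨hum, -⟩, huin, huout⟩ := hu
  have hu01 : ∀ x, 0 ≤ u x ∧ u x ≤ 1 := by
    intro x
    by_cases hx : x ∈ ball x₀ R
    · exact ⟨(indicator_nonneg (fun _ _ => zero_le_one) x).trans (huin x hx).1, (huin x hx).2⟩
    · rw [huout x hx]; exact ⟨le_rfl, zero_le_one⟩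
  obtain ⟨f, rfl⟩ : ∃ f : X → ℝ, u = fun x => (f x : EReal) := by
    refine ⟨fun x => (u x).toReal, funext fun x => (EReal.coe_toReal ?_ ?_).symm⟩
    · exact fun h => absurd (hu01 x).2 (by rw [h]; exact not_le.2 (EReal.coe_lt_top 1))
    · exact fun h => absurd (hu01 x).1 (by rw [h]; exact not_le.2 (EReal.bot_lt_coe 0))
  have hf : ∀ x, 0 ≤ f x ∧ f x ≤ 1 := fun x =>
    ⟨EReal.coe_nonneg.1 (hu01 x).1, EReal.coe_le_coe_iff.1 (hu01 x).2⟩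
  have hf1 : ∀ x ∈ ball x₀ r, f x = 1 := by
    intro x hx
    have h := (huin x (ball_subset_ball hrR.le hx)).1
    rw [indicator_of_mem hx] at h
    exact le_antisymm (hf x).2 (EReal.coe_le_coe_iff.1 h)
  have hf0 : ∀ x ∉ ball x₀ R, f x = 0 := fun x hx => EReal.coe_eq_zero.1 (huout x hx)
  have h1 := le_lintegral_annulus hp hμ hP hτ hκ hR hrR hrev ha haκ hum hf hf1 hf0 hg hgp
  set A := ball x₀ R \ ball x₀ r with hA
  have h2 := rpow_lintegral_le hp hg.1 A
  set I := ∫⁻ x in A, g x ∂μ with hI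
  set e := ∫⁻ x in ball x₀ R, g x ^ p ∂μ with he
  have h3 : I ^ p ≤ (ENNReal.ofReal (K * (1 - r / R)) * μ (ball x₀ R)) ^ (p - 1) * e := by
    refine h2.trans (mul_le_mul' (ENNReal.rpow_le_rpow ?_ (by linarith))
      (lintegral_mono_set sdiff_subset))
    refine (hCA r R hr hrR).trans ?_
    rw [Real.rpow_one]
    gcongr
  have hefin : e ≠ ∞ := ((lintegral_mono' Measure.restrict_le_self le_rfl).trans_lt hgp).ne
  have hm0 : 0 < (μ (ball x₀ R)).toReal := ENNReal.toReal_pos (hμ R hR).1.ne' (hμ R hR).2.ne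
  rw [← ENNReal.ofReal_toReal (hμ R hR).2.ne] at h1 h3 ⊢
  rw [← ENNReal.ofReal_toReal hefin] at h3 ⊢
  set m := (μ (ball x₀ R)).toReal with hm
  set e' := e.toReal with he'
  have hnn : 0 ≤ K * (1 - r / R) := by positivity
  rw [← ENNReal.ofReal_mul hnn, ENNReal.ofReal_rpow_of_pos (by positivity),
    ← ENNReal.ofReal_mul (by positivity)] at h3
  have h4 : ENNReal.ofReal (a * m / (CP * (τ * R))) ≤ I := by
    rw [ENNReal.ofReal_div_of_pos (by positivity), ENNReal.ofReal_mul ha0.le]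
    refine ENNReal.div_le_of_le_mul ?_
    rwa [mul_comm I]
  have h5 := (ENNReal.rpow_le_rpow h4 hp0.le).trans h3
  rw [ENNReal.ofReal_rpow_of_pos (by positivity),
    ENNReal.ofReal_le_ofReal_iff (by positivity)] at h5
  rw [← ENNReal.ofReal_mul (by positivity)]
  apply ENNReal.ofReal_le_ofReal
  have hδm : 0 < K * (1 - r / R) * m := by positivity
  -- The right-hand side is the lower bound for `I ^ p` divided by the Hölder factor in `h3`; the
  -- powers of `m` combine to `m` itself.
  have h6 : (a / (CP * τ)) ^ p * K ^ (1 - p) * ((1 - r / R) ^ (1 - p) / R ^ p) * m =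
      (K * (1 - r / R) * m) ^ (1 - p) * (a * m / (CP * (τ * R))) ^ p := by
    rw [show a * m / (CP * (τ * R)) = a / (CP * τ) * m / R by field_simp,
      Real.div_rpow (by positivity) hR.le, Real.mul_rpow (x := a / (CP * τ)) (by positivity) hm0.le,
      Real.mul_rpow (x := K * (1 - r / R)) hnn hm0.le, Real.mul_rpow hK.le hδ.le]
    have h7 : m ^ (1 - p) * m ^ p = m := by
      rw [← Real.rpow_add hm0, sub_add_cancel, Real.rpow_one]
    conv_lhs => rw [← h7]
    ring
  rw [h6]
  calc (K * (1 - r / R) * m) ^ (1 - p) * (a * m / (CP * (τ * R))) ^ p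
      ≤ (K * (1 - r / R) * m) ^ (1 - p) * ((K * (1 - r / R) * m) ^ (p - 1) * e') := by gcongr
    _ = e' := by
        rw [← mul_assoc, ← Real.rpow_add hδm]
        simp

end

end MetricMeasure

/-! ### Choice of the constant. -/

theorem mainTheorem2 (p : ℝ) (hp : 1 ≤ p) (CP lam CA τ κ : ℝ) :
    ∃ C : ℝ, 0 < C ∧
      ∀ (X : Type*) [MetricSpace X] [MeasurableSpace X] [BorelSpace X] (μ : Measure X),
        (∀ (x : X) (r : ℝ), 0 < r → 0 < μ (ball x r) ∧ μ (ball x r) < ∞) →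
        ∀ x₀ : X,
          MetricMeasure.PoincareAt 1 μ x₀ CP lam →
          MetricMeasure.AnnularDecayAt 1 μ x₀ CA →
          MetricMeasure.ReverseDoublingAt μ x₀ τ κ →
          ∀ r R : ℝ, 0 < R / 2 → R / 2 ≤ r → r < R →
            ENNReal.ofReal R ≤ ediam (univ : Set X) / ENNReal.ofReal (2 * τ) →
            ENNReal.ofReal (C⁻¹ * ((1 - r / R) ^ (1 - p) / R ^ p)) * μ (ball x₀ R) ≤
                MetricMeasure.variationalCapacity p μ (ball x₀ r) (ball x₀ R) ∧
              MetricMeasure.variationalCapacity p μ (ball x₀ r) (ball x₀ R) ≤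
                ENNReal.ofReal (C * ((1 - r / R) ^ (1 - p) / R ^ p)) * μ (ball x₀ R) := by
  by_cases hpar : 0 < CP ∧ 1 < τ ∧ 1 < κ
  swap
  · refine ⟨1, one_pos, fun X _ _ _ μ _ x₀ hP _ hrev => absurd ⟨hP.1, hrev.1, hrev.2.1⟩ hpar⟩
  obtain ⟨hCP, hτ, hκ⟩ := hpar
  -- `CA` comes without a sign; `K ≥ 1` makes the shrinking factor `1 - 1 / (2 * K)` lie in `[1/2,
  -- 1)`.
  set K : ℝ := max CA 1 with hKdef
  have hK1 : 1 ≤ K := le_max_right _ _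
  have hK0 : 0 < K := by linarith
  have hCK : CA ≤ K := le_max_left _ _
  obtain ⟨n, hn⟩ : ∃ n : ℕ, (1 - 1 / (2 * K)) ^ n < 1 / 2 := by
    refine exists_pow_lt_of_lt_one (by norm_num) ?_
    have : 0 < 1 / (2 * K) := by positivity
    linarith
  -- The two entries bound the measures of `B_r` and of `B_{τR} \ B_R` from below, relative to
  -- `μ(B_R)`.
  set a : ℝ := min ((2 ^ n)⁻¹) (κ - 1) with ha
  have ha0 : 0 < a := lt_min (by positivity) (by linarith)
  set c : ℝ := (a / (CP * τ)) ^ p * K ^ (1 - p) with hc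
  have hc0 : 0 < c := by positivity
  refine ⟨max K c⁻¹, lt_max_of_lt_left hK0, ?_⟩
  intro X _ _ _ μ hμ x₀ hP hCA hrev r R hR2 hr hrR hdiam
  have hR : 0 < R := by linarith
  have hr0 : 0 < r := by linarith
  have hδ : 0 < 1 - r / R := sub_pos.2 ((div_lt_one hR).2 hrR)
  have hnn : 0 ≤ (1 - r / R) ^ (1 - p) / R ^ p := by positivity
  constructor
  · have hball : ENNReal.ofReal a * μ (ball x₀ R) ≤ μ (ball x₀ r) := by
      have h1 := hCA.measure_ball_le (fun s hs => (hμ x₀ s hs).2) hK1 hCK hn.le hR hr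
      calc ENNReal.ofReal a * μ (ball x₀ R)
          ≤ ENNReal.ofReal ((2 ^ n)⁻¹) * (2 ^ n * μ (ball x₀ r)) := by
            gcongr
            exact min_le_left _ _
        _ = μ (ball x₀ r) := by
            rw [ENNReal.ofReal_inv_of_pos (by positivity), ENNReal.ofReal_pow zero_le_two,
              ENNReal.ofReal_ofNat, ← mul_assoc, ENNReal.inv_mul_cancel (by simp) (by simp),
              one_mul]
    refine le_trans ?_ (MetricMeasure.le_capacity hp (hμ x₀) hP hCA hCK hK0 hτ hκ hr0 hrR
      (hrev.2.2 R hR hdiam) ha0 hball (min_le_right _ _))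
    gcongr
    exact inv_le_of_inv_le₀ hc0 (le_max_right _ _)
  · refine (MetricMeasure.capacity_le hp (fun s hs => (hμ x₀ s hs).2) hCA hCK hr0 hrR).trans ?_
    gcongr
    exact le_max_left _ _
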